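/- \textbf{Setting.} Let $n,m,p$ be non-negative integers. A \emph{structured matrix} $\bar M\in\{0,*\}^{n_1\times n_2}$ is a matrix each of whose entries is a fixed zero or an independent free real parameter $*$; a \emph{realization} $M$ of $\bar M$ is a real matrix obtained by giving arbitrary real values to the $*$ entries. The \emph{generic rank} $\operatorname{grank}$ of a structured matrix, or of a matrix whose entries are polynomials in the free parameters, is the maximum of its rank over all real values of the free parameters. Let $\bar A\in\{0,*\}^{n\times n}$, $\bar B\in\{0,*\}^{n\times m}$, $\bar C\in\{0,*\}^{p\times n}$, and let $Q(\bar A,\bar B)=[\bar B,\bar A\bar B,\dots,\bar A^{n-1}\bar B]$, a matrix depending on the free parameters of $\bar A$ and $\bar B$. A real system $\dot x=Ax+Bu$, $y=Cx$ is \emph{output controllable} if for every initial state $x_0\in\mathbb R^n$ (hence from every initial output $y(0)=Cx_0$) and every $y_f\in\mathbb R^p$ there are a finite time $T>0$ and an integrable input $u:[0,T]\to\mathbb R^m$ such that the solution with $x(0)=x_0$ satisfies $y(T)=y_f$. The triple $(\bar A,\bar B,\bar C)$ is \emph{structurally output controllable} if some realization $(A,B,C)$ of it is output controllable. Let $\mathcal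 G(\bar A,\bar B)$ be the digraph with vertices $x_1,\dots,x_n,u_1,\dots,u_m$ and edges $(x_i,x_j)$ whenever $\bar A_{ji}\neq0$ and $(u_i,x_j)$ whenever $\bar B_{ji}\ne0$. A state vertex $x_i$ is \emph{input-reachable} if there is a directed path to it from some $u_j$. Let $\bar A_r\in\{0,*\}^{n\times n}$ be obtained from $\bar A$ by replacing with zeros all rows and columns corresponding to state vertices that are not input-reachable. Let $\mathcal D(\bar A_r,\bar B,\bar C)$ be the digraph with the pairwise disjoint vertex sets $X^2=\{x_1^2,\dots,x_n^2\}$, $U^2=\{u_1,\dots,u_m\}$, $X^1=\{x_1^1,\dots,x_n^1\}$, $Y^0=\{y_1,\dots,y_p\}$ and with the edges $(x_i^2,x_j^1)$ whenever $[\bar A_r]_{ji}\neq0$, $(u_i,x_j^1)$ whenever $\bar B_{ji}\ne0$, and $(x_i^1,y_j)$ whenever $\bar C_{ji}\neq0$. A \emph{linking of size $l$ from $X^2\cup U^2$ to $Y^0$} is a collection of $l$ pairwise vertex-disjoint simple directed paths, each with initial vertex in $X^2\cup U^2$ and terminal vertex in $Y^0$. \textbf{Theorem.} Suppose that $\operatorname{grank}\,[\bar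 A_r,\bar B]=\operatorname{grank}\,Q(\bar A,\bar B)$. Then $(\bar A,\bar B,\bar C)$ is structurally output controllable if and only if there is a linking of size $p$ from $X^2\cup U^2$ to $Y^0$ in $\mathcal D(\bar A_r,\bar B,\bar C)$. -/

import Mathlib

namespace StructuredSystem

/-! ### Structured matrices and generic rank -/

/-- A structured matrix, an element of `{0,*}^{ι × κ}`: the entry `(i, j)` is a free parameter `*`
if `S i j` holds, and a fixed zero otherwise. -/
abbrev StructuredMatrix (ι κ : Type*) := Matrix ι κ Prop

/-- The realizations of a structured matrix: arbitrary real values at the `*` entries and zero at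
all other entries. This is the parameter space `ℝ^{n_S}`, with `n_S` the number of `*` entries. -/
abbrev Realization {ι κ : Type*} (S : StructuredMatrix ι κ) :=
  {M : Matrix ι κ ℝ // ∀ i j, ¬ S i j → M i j = 0}

/-- The generic rank of a matrix `P` that depends on free parameters `θ : Θ`: the maximum of its
rank over all values of the parameters. (The ranks are bounded by the number of columns, so that
the supremum in `ℕ` is a maximum.) -/
noncomputable def genericRank {Θ ι κ : Type*} [Fintype κ] (P : Θ → Matrix ι κ ℝ) : ℕ :=
  ⨆ θ, (P θ).rank

/-- The generic rank of a structured matrix. -/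
noncomputable def grank {ι κ : Type*} [Fintype κ] (S : StructuredMatrix ι κ) : ℕ :=
  genericRank fun M : Realization S => M.1

/-- The controllability matrix `Q(A,B) = [B, AB, …, A^{n-1}B]`; its column `(k, j)` is the
`j`-th column of `A^k B`. -/
def controllabilityMatrix {n m : ℕ} (A : Matrix (Fin n) (Fin n) ℝ) (B : Matrix (Fin n) (Fin m) ℝ) :
    Matrix (Fin n) (Fin n × Fin m) ℝ :=
  Matrix.of fun i kj => (A ^ (kj.1 : ℕ) * B) i kj.2

/-- The generic rank of `Q(Ā,B̄)` as a function of the free parameters in `(Ā,B̄)`. -/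
noncomputable def grankQ {n m : ℕ} (A : StructuredMatrix (Fin n) (Fin n))
    (B : StructuredMatrix (Fin n) (Fin m)) : ℕ :=
  genericRank fun θ : Realization A × Realization B => controllabilityMatrix θ.1.1 θ.2.1

/-! ### Output controllability -/

/-- `x` is a trajectory on `[0,T]` of `x' = A x + B u` that starts at `x₀`, with an integrable
input `u : [0,T] → ℝ^m`: it is continuous and solves the integrated equation. -/
structure IsTrajectory {n m : ℕ} (A : Matrix (Fin n) (Fin n) ℝ) (B : Matrix (Fin n) (Fin m) ℝ)
    (T : ℝ) (x₀ : Fin n → ℝ) (u : ℝ → Fin m → ℝ) (x : ℝ → Fin n → ℝ) : Prop where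
  integrable_input : IntervalIntegrable u MeasureTheory.volume 0 T
  continuousOn : ContinuousOn x (Set.Icc 0 T)
  eq_integral : ∀ t ∈ Set.Icc 0 T,
    x t = x₀ + ∫ s in (0 : ℝ)..t, (A.mulVec (x s) + B.mulVec (u s))

/-- The system `x' = A x + B u`, `y = C x` is output controllable: from every initial state `x₀`
(hence from every initial output `y₀ = C x₀`), every final output `yf` is reached at some finite
time `T` under some input. -/
def OutputControllable {n m p : ℕ} (A : Matrix (Fin n) (Fin n) ℝ) (B : Matrix (Fin n) (Fin m) ℝ)
    (C : Matrix (Fin p) (Fin n) ℝ) : Prop :=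
  ∀ (x₀ : Fin n → ℝ) (yf : Fin p → ℝ), ∃ (T : ℝ) (u : ℝ → Fin m → ℝ) (x : ℝ → Fin n → ℝ),
    0 < T ∧ IsTrajectory A B T x₀ u x ∧ C.mulVec (x T) = yf

/-- `(Ā,B̄,C̄)` is structurally output controllable: some realization is output controllable. -/
def StructurallyOutputControllable {n m p : ℕ} (A : StructuredMatrix (Fin n) (Fin n))
    (B : StructuredMatrix (Fin n) (Fin m)) (C : StructuredMatrix (Fin p) (Fin n)) : Prop :=
  ∃ (A' : Realization A) (B' : Realization B) (C' : Realization C),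
    OutputControllable A'.1 B'.1 C'.1

/-! ### Input-reachable states -/

/-- State and input vertices of the digraph `𝒢(Ā,B̄)`. -/
inductive SystemVertex (n m : ℕ)
  | state (i : Fin n)
  | input (j : Fin m)

/-- The digraph `𝒢(Ā,B̄)`: edges `x_i → x_j` for `Ā_{ji} ≠ 0` and `u_i → x_j` for `B̄_{ji} ≠ 0`. -/
def systemDigraph {n m : ℕ} (A : StructuredMatrix (Fin n) (Fin n))
    (B : StructuredMatrix (Fin n) (Fin m)) : Digraph (SystemVertex n m) where
  Adj
    | .state i, .state j => A j i
    | .input i, .state j => B j i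
    | _, .input _ => False

/-- The state `x_i` is input-reachable: there is a path to it in `𝒢(Ā,B̄)` from some input. -/
def InputReachable {n m : ℕ} (A : StructuredMatrix (Fin n) (Fin n))
    (B : StructuredMatrix (Fin n) (Fin m)) (i : Fin n) : Prop :=
  ∃ j : Fin m, Relation.ReflTransGen (systemDigraph A B).Adj (.input j) (.state i)

/-- `Ā_r`: the rows and columns of `Ā` at states that are not input-reachable are set to zero. -/
def reachablePart {n m : ℕ} (A : StructuredMatrix (Fin n) (Fin n))
    (B : StructuredMatrix (Fin n) (Fin m)) : StructuredMatrix (Fin n) (Fin n) :=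
  fun i j => A i j ∧ InputReachable A B i ∧ InputReachable A B j

/-! ### The auxiliary digraph and linkings -/

/-- A simple path of a digraph, given by the list of its vertices (of length zero if there is only
one vertex). -/
structure SimplePath {V : Type*} (G : Digraph V) where
  support : List V
  ne_nil : support ≠ []
  isChain : support.IsChain G.Adj
  nodup : support.Nodup

/-- `G` has a linking of size `l` from `S` to `T`: there are `l` pairwise vertex-disjoint simple
paths, each with its initial vertex in `S` and its terminal vertex in `T`. -/
def HasLinking {V : Type*} (G : Digraph V) (S T : Set V) (l : ℕ) : Prop :=
  ∃ P : Fin l → SimplePath G,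
    (∀ k, (P k).support.head (P k).ne_nil ∈ S ∧ (P k).support.getLast (P k).ne_nil ∈ T) ∧
    Pairwise fun k k' => List.Disjoint (P k).support (P k').support

/-- The vertices of the auxiliary digraph: `x2 i` is `x_i²`, `u2 j` is `u_j`, `x1 i` is `x_i¹`,
and `y0 k` is `y_k`. -/
inductive AuxVertex (n m p : ℕ)
  | x2 (i : Fin n)
  | u2 (j : Fin m)
  | x1 (i : Fin n)
  | y0 (k : Fin p)

/-- The digraph `𝒟(Ā,B̄,C̄)`: edges `x_i² → x_j¹` for `Ā_{ji} ≠ 0`, `u_i → x_j¹` for `B̄_{ji} ≠ 0`,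
and `x_i¹ → y_j` for `C̄_{ji} ≠ 0`. -/
def auxDigraph {n m p : ℕ} (A : StructuredMatrix (Fin n) (Fin n))
    (B : StructuredMatrix (Fin n) (Fin m)) (C : StructuredMatrix (Fin p) (Fin n)) :
    Digraph (AuxVertex n m p) where
  Adj
    | .x2 i, .x1 j => A j i
    | .u2 i, .x1 j => B j i
    | .x1 i, .y0 j => C j i
    | _, _ => False

/-- `X² ∪ U²`. -/
def auxSources (n m p : ℕ) : Set (AuxVertex n m p) :=
  Set.range AuxVertex.x2 ∪ Set.range AuxVertex.u2

/-- `Y⁰`. -/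
def auxSinks (n m p : ℕ) : Set (AuxVertex n m p) :=
  Set.range AuxVertex.y0

end StructuredSystem

open StructuredSystem

/-! A real system is output controllable exactly when `C * Q(A,B)` has independent rows
(`outputControllable_iff`), so the theorem compares the row rank of `C * Q` with that of `C * [A_r,
B]`. The columns of `A ^ k * B` are supported on input-reachable states, hence replacing `A` by its
reachable part leaves `Q` unchanged (`controllabilityMatrix_restrict`). Moreover `Q = [A_r, B] * N`
for some `N`.

If `C * Q` has independent rows, so has `C * [A_r, B]`. A nonzero maximal minor of this product,
expanded first along the product and then by the Leibniz formula, has a nonzero term; its factors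
are the edges of a linking.

Conversely, a linking supplies 0-1 realizations for which a maximal minor of `C * [A_r, B]` is
nonzero. Another realization gives `Q` its generic rank. On the line joining them both conditions
are nonvanishing of polynomials in one variable, so they hold together at some point. There the
generic rank equality forces the column spaces of `Q` and `[A_r, B]` to coincide, and the
independent rows pass from `C * [A_r, B]` to `C * Q`. -/

/-! ### Linear differential equations with inputs -/

section LinearODE

variable {E F G : Type*} [NormedAddCommGroup E] [NormedSpace ℝ E] [CompleteSpace E]
  [NormedAddCommGroup F] [NormedSpace ℝ F] [NormedAddCommGroup G] [NormedSpace ℝ G]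

/-- A functional that annihilates all `A ^ k B` vanishes along trajectories that start at `0`. -/
theorem functional_trajectory_eq_zero (A : E →L[ℝ] E) (B : F →L[ℝ] E) (l : E →L[ℝ] ℝ) {T : ℝ}
    {u : ℝ → F} {x : ℝ → E} (hl : ∀ k y, l ((A ^ k) (B y)) = 0)
    (hu : IntervalIntegrable u MeasureTheory.volume 0 T) (hx : ContinuousOn x (Set.Icc 0 T))
    (hxu : ∀ t ∈ Set.Icc 0 T, x t = ∫ s in (0 : ℝ)..t, (A (x s) + B (u s))) :
    ∀ t ∈ Set.Icc 0 T, l (x t) = 0 := by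
  -- The input term is killed by `l ∘ A ^ k`, so each use of the integral equation trades one
  -- integration for one more power of `A`.
  have step : ∀ k, ∀ t ∈ Set.Icc 0 T,
      l ((A ^ k) (x t)) = ∫ s in (0 : ℝ)..t, l ((A ^ (k + 1)) (x s)) := by
    intro k t ht
    have hsub : Set.uIcc 0 t ⊆ Set.Icc 0 T := by
      rw [Set.uIcc_of_le ht.1]; exact Set.Icc_subset_Icc_right ht.2
    have h1 : IntervalIntegrable (fun s => A (x s)) MeasureTheory.volume 0 t :=
      (A.continuous.comp_continuousOn (hx.mono hsub)).intervalIntegrable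
    have h2 : IntervalIntegrable (fun s => B (u s)) MeasureTheory.volume 0 t := by
      have hu' : IntervalIntegrable u MeasureTheory.volume 0 t := hu.mono_set (by
        rw [Set.uIcc_of_le (ht.1.trans ht.2)]; exact hsub)
      exact ⟨B.integrable_comp hu'.1, B.integrable_comp hu'.2⟩
    have h3 := (l.comp (A ^ k)).intervalIntegral_comp_comm (h1.add h2)
    rw [hxu t ht]
    change (l.comp (A ^ k)) _ = _
    rw [← h3]
    refine intervalIntegral.integral_congr fun s _ => ?_
    change l ((A ^ k) (A (x s) + B (u s))) = _
    rw [map_add, map_add, hl, add_zero, pow_succ]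
    rfl
  obtain ⟨M, hM⟩ := isCompact_Icc.exists_bound_of_continuousOn hx
  -- After `j` integrations the factor `t ^ j / j!` outweighs the growth `‖A‖ ^ j`; this is a
  -- Gronwall argument by iteration.
  have bound : ∀ j k, ∀ t ∈ Set.Icc 0 T,
      |l ((A ^ k) (x t))| ≤ ‖l‖ * ‖A‖ ^ (k + j) * M * (t ^ j / (j.factorial : ℝ)) := by
    intro j
    induction j with
    | zero =>
      intro k t ht
      -- The case `k = 0` is separate because the identity has norm `0` when `E` is trivial.
      have hA : ‖A ^ k‖ ≤ ‖A‖ ^ k := by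
        rcases k with _ | k
        · rw [pow_zero, pow_zero]; exact ContinuousLinearMap.norm_id_le
        · exact norm_pow_le' A k.succ_pos
      calc |l ((A ^ k) (x t))| ≤ ‖l‖ * ‖(A ^ k) (x t)‖ := l.le_opNorm _
        _ ≤ ‖l‖ * (‖A ^ k‖ * ‖x t‖) := by gcongr; exact (A ^ k).le_opNorm _
        _ ≤ ‖l‖ * (‖A‖ ^ k * M) := by gcongr; exact hM t ht
        _ = _ := by simp; ring
    | succ j ih =>
      intro k t ht
      rw [step k t ht]
      have hint : ∫ s in (0 : ℝ)..t, ‖l‖ * ‖A‖ ^ (k + 1 + j) * M * (s ^ j / (j.factorial : ℝ)) =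
          ‖l‖ * ‖A‖ ^ (k + (j + 1)) * M * (t ^ (j + 1) / ((j + 1).factorial : ℝ)) := by
        rw [intervalIntegral.integral_const_mul, intervalIntegral.integral_div, integral_pow,
          Nat.factorial_succ, show k + 1 + j = k + (j + 1) by ring]
        have : (j.factorial : ℝ) ≠ 0 := by positivity
        push_cast
        field_simp
        simp
      rw [← hint, ← Real.norm_eq_abs]
      refine intervalIntegral.norm_integral_le_of_norm_le ht.1 ?_ ?_
      · refine Filter.Eventually.of_forall fun s hs => ?_
        exact ih (k + 1) s ⟨hs.1.le, hs.2.trans ht.2⟩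
      · exact Continuous.intervalIntegrable (by fun_prop) _ _
  intro t ht
  have hlim : Filter.Tendsto (fun j : ℕ => ‖l‖ * M * ((‖A‖ * t) ^ j / (j.factorial : ℝ)))
      Filter.atTop (nhds 0) := by
    simpa using (FloorSemiring.tendsto_pow_div_factorial_atTop (‖A‖ * t)).const_mul (‖l‖ * M)
  have hle : |l (x t)| ≤ 0 := by
    refine ge_of_tendsto' hlim fun j => ?_
    have := bound j 0 t ht
    simp only [pow_zero, zero_add] at this
    refine (this.trans_eq ?_)
    rw [mul_pow]; ring
  exact abs_nonpos_iff.1 hle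

theorem hasDerivAt_variation_of_constants (A : E →L[ℝ] E) (x₀ : E) {b : ℝ → E}
    (hb : Continuous b) (t : ℝ) :
    HasDerivAt (fun t : ℝ => NormedSpace.exp (t • A)
        (x₀ + ∫ s in (0 : ℝ)..t, NormedSpace.exp (-(s • A)) (b s)))
      (A (NormedSpace.exp (t • A) (x₀ + ∫ s in (0 : ℝ)..t, NormedSpace.exp (-(s • A)) (b s)))
        + b t) t := by
  let _ : NormedAlgebra ℚ (E →L[ℝ] E) := NormedAlgebra.restrictScalars ℚ ℝ _
  have hcont : Continuous fun s : ℝ => NormedSpace.exp (-(s • A)) (b s) := by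
    have : Continuous fun s : ℝ => NormedSpace.exp (-(s • A)) :=
      NormedSpace.exp_continuous.comp (by fun_prop)
    exact this.clm_apply hb
  have h1 : HasDerivAt (fun t : ℝ => NormedSpace.exp (t • A)) (A * NormedSpace.exp (t • A)) t :=
    hasDerivAt_exp_smul_const' A t
  have h2 : HasDerivAt (fun t : ℝ => x₀ + ∫ s in (0 : ℝ)..t, NormedSpace.exp (-(s • A)) (b s))
      (NormedSpace.exp (-(t • A)) (b t)) t :=
    (hcont.integral_hasStrictDerivAt 0 t).hasDerivAt.const_add x₀
  have h3 := h1.clm_apply h2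
  have h4 : NormedSpace.exp (t • A) (NormedSpace.exp (-(t • A)) (b t)) = b t := by
    have : NormedSpace.exp (t • A) * NormedSpace.exp (-(t • A)) = 1 := by
      rw [← NormedSpace.exp_add_of_commute (Commute.neg_right rfl)]; simp
    simpa using DFunLike.congr_fun this (b t)
  rw [h4] at h3
  exact h3

/-- A functional that annihilates `exp (-s A) v` for `s ∈ [0,1]` annihilates the derivatives. -/
theorem functional_exp_eq_zero (A : E →L[ℝ] E) (g : E →L[ℝ] ℝ) (v : E)
    (h : ∀ s ∈ Set.Icc (0 : ℝ) 1, g (NormedSpace.exp (-(s • A)) v) = 0) (k : ℕ) :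
    ∀ s ∈ Set.Icc (0 : ℝ) 1, g ((A ^ k) (NormedSpace.exp (-(s • A)) v)) = 0 := by
  let _ : NormedAlgebra ℚ (E →L[ℝ] E) := NormedAlgebra.restrictScalars ℚ ℝ _
  have hder : ∀ s : ℝ, HasDerivAt (fun s : ℝ => NormedSpace.exp (-(s • A)))
      (-(A * NormedSpace.exp (-(s • A)))) s := by
    intro s
    have := hasDerivAt_exp_smul_const' (-A) s
    simpa using this
  induction k with
  | zero => simpa using h
  | succ k ih =>
    set f : ℝ → ℝ := fun s => g ((A ^ (k + 1)) (NormedSpace.exp (-(s • A)) v)) with hf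
    have hcont : Continuous f := by
      have : Continuous fun s : ℝ => NormedSpace.exp (-(s • A)) :=
        NormedSpace.exp_continuous.comp (by fun_prop)
      fun_prop
    -- `-f` is the derivative of the function for `k`, which vanishes on `[0,1]`. This gives the
    -- open interval; continuity adds the endpoints.
    have hopen : Set.EqOn f (fun _ => 0) (Set.Ioo 0 1) := by
      intro s hs
      have hd : HasDerivAt (fun s : ℝ => g ((A ^ k) (NormedSpace.exp (-(s • A)) v))) (-f s) s := by
        have h1 := (hder s).clm_apply (hasDerivAt_const s v)
        have h2 := (g.comp (A ^ k)).hasFDerivAt.comp_hasDerivAt s h1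
        have h3 : -f s = (g.comp (A ^ k)) ((-(A * NormedSpace.exp (-(s • A)))) v +
            NormedSpace.exp (-(s • A)) 0) := by
          rw [map_zero, add_zero, neg_apply, map_neg, hf, pow_succ]
          rfl
        rw [h3]
        exact h2
      have hz : HasDerivAt (fun s : ℝ => g ((A ^ k) (NormedSpace.exp (-(s • A)) v))) 0 s := by
        refine (hasDerivAt_const s (0 : ℝ)).congr_of_eventuallyEq ?_
        filter_upwards [Icc_mem_nhds hs.1 hs.2] with r hr using ih r hr
      simpa using hd.unique hz
    have := hopen.closure hcont continuous_const
    rwa [closure_Ioo zero_ne_one] at this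

/-- If no nonzero functional of the output annihilates all `C A ^ k B`, then every final output is
reached at time `1` under a continuous input. -/
theorem exists_control_of_forall_functional [FiniteDimensional ℝ G] (A : E →L[ℝ] E)
    (B : F →L[ℝ] E) (C : E →L[ℝ] G)
    (h : ∀ f : G →ₗ[ℝ] ℝ, (∀ k y, f (C ((A ^ k) (B y))) = 0) → f = 0) (x₀ : E) (yf : G) :
    ∃ (u : ℝ → F) (x : ℝ → E), Continuous u ∧ x 0 = x₀ ∧ C (x 1) = yf ∧
      ∀ t, HasDerivAt x (A (x t) + B (u t)) t := by
  let _ : NormedAlgebra ℚ (E →L[ℝ] E) := NormedAlgebra.restrictScalars ℚ ℝ _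
  have hexp : Continuous fun s : ℝ => NormedSpace.exp (-(s • A)) :=
    NormedSpace.exp_continuous.comp (by fun_prop)
  have hcont : ∀ u : C(ℝ, F), Continuous fun s : ℝ => NormedSpace.exp (-(s • A)) (B (u s)) :=
    fun u => hexp.clm_apply (by fun_prop)
  let I : C(ℝ, F) →ₗ[ℝ] G :=
    { toFun := fun u =>
        C (NormedSpace.exp A (∫ s in (0 : ℝ)..1, NormedSpace.exp (-(s • A)) (B (u s))))
      map_add' := fun u v => by
        rw [← map_add, ← map_add, ← intervalIntegral.integral_add
          ((hcont u).intervalIntegrable _ _) ((hcont v).intervalIntegrable _ _)]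
        simp
      map_smul' := fun c u => by
        simp [intervalIntegral.integral_smul] }
  have hI : LinearMap.range I = ⊤ := by
    by_contra hne
    obtain ⟨f, hf0, hf⟩ := Submodule.exists_le_ker_of_lt_top _ (lt_top_iff_ne_top.2 hne)
    refine hf0 (h f fun k y => ?_)
    let g : E →L[ℝ] ℝ := ((LinearMap.toContinuousLinearMap f).comp C).comp (NormedSpace.exp A)
    have hg : ∀ v, g v = f (C (NormedSpace.exp A v)) := fun v => rfl
    let ψ : ℝ → ℝ := fun s => g (NormedSpace.exp (-(s • A)) (B y))
    have hψ : Continuous ψ := by fun_prop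
    have hz : ∀ s ∈ Set.Icc (0 : ℝ) 1, g (NormedSpace.exp (-(s • A)) (B y)) = 0 := by
      by_contra! hs
      obtain ⟨s, hs, hs0⟩ := hs
      -- The input in direction `y` weighted by `ψ` itself turns `f (I u)` into the integral of `ψ ^
      -- 2`.
      let u : C(ℝ, F) := ⟨fun s => ψ s • y, by fun_prop⟩
      have h0 : f (I u) = 0 := hf ⟨u, rfl⟩
      have h1 : f (I u) = ∫ s in (0 : ℝ)..1, ψ s * ψ s := by
        change g (∫ s in (0 : ℝ)..1, NormedSpace.exp (-(s • A)) (B (u s))) = _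
        rw [← g.intervalIntegral_comp_comm ((hcont u).intervalIntegrable _ _)]
        simp [u, ψ]
      have h2 : 0 < ∫ s in (0 : ℝ)..1, ψ s * ψ s :=
        intervalIntegral.integral_pos one_pos (by fun_prop) (fun s _ => mul_self_nonneg _)
          ⟨s, hs, mul_self_pos.2 hs0⟩
      linarith
    -- At `s = 1` the factor `exp (-A)` cancels the `exp A` inside `g`.
    have h1 := functional_exp_eq_zero A g (B y) hz k 1 (by simp)
    rw [hg] at h1
    have hcomm : NormedSpace.exp A * (A ^ k * NormedSpace.exp (-((1 : ℝ) • A))) = A ^ k := by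
      have h2 : Commute (NormedSpace.exp A) (A ^ k) :=
        ((Commute.refl A).exp_left).pow_right k
      rw [← mul_assoc, h2.eq, mul_assoc, one_smul,
        ← NormedSpace.exp_add_of_commute (Commute.neg_right rfl)]
      simp
    have h3 := DFunLike.congr_fun hcomm (B y)
    change NormedSpace.exp A ((A ^ k) (NormedSpace.exp (-((1 : ℝ) • A)) (B y))) = _ at h3
    rwa [h3] at h1
  -- The target is corrected by the output of the free motion from `x₀`.
  obtain ⟨u, hu⟩ := LinearMap.range_eq_top.1 hI (yf - C (NormedSpace.exp A x₀))
  refine ⟨u, fun t : ℝ => NormedSpace.exp (t • A)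
        (x₀ + ∫ s in (0 : ℝ)..t, NormedSpace.exp (-(s • A)) (B (u s))), u.continuous, ?_, ?_,
        fun t => hasDerivAt_variation_of_constants A x₀ (by fun_prop) t⟩
  · simp
  · change C (NormedSpace.exp A (∫ s in (0 : ℝ)..1, NormedSpace.exp (-(s • A)) (B (u s)))) = _ at hu
    simp [hu]

end LinearODE

/-! ### Ranks and minors -/

section LinearAlgebra

open Matrix

/-- Over the reals, a vector in the left kernel of a Gram matrix is already in that of `K`. -/
theorem det_mul_transpose_ne_zero {p : ℕ} {κ : Type*} [Fintype κ] {K : Matrix (Fin p) κ ℝ}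
    (hK : ∀ w, w ᵥ* K = 0 → w = 0) : (K * Kᵀ).det ≠ 0 := by
  intro h0
  obtain ⟨w, hw0, hw⟩ := Matrix.exists_vecMul_eq_zero_iff.2 h0
  refine hw0 (hK w ?_)
  have := (Matrix.vecMul_self_mul_conjTranspose_eq_zero K w).1
    (by rwa [Matrix.conjTranspose_eq_transpose_of_trivial])
  exact this

/-- A nonzero minor in the sense of a nonsingular compression. -/
theorem exists_det_compression_ne_zero {ι κ : Type*} [Fintype ι] [Fintype κ]
    (M : Matrix ι κ ℝ) : ∃ (L : Matrix (Fin M.rank) ι ℝ) (R : Matrix κ (Fin M.rank) ℝ),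
      (L * M * R).det ≠ 0 := by
  let b : Module.Basis (Fin M.rank) ℝ (LinearMap.range M.mulVecLin) := Module.finBasis _ _
  choose c hc using fun j => (b j).2
  let R : Matrix κ (Fin M.rank) ℝ := Matrix.of fun i j => c j i
  -- The columns of `M * R` form a basis of the range of `M`, so their Gram matrix is nonsingular.
  refine ⟨(M * R)ᵀ, R, ?_⟩
  rw [Matrix.mul_assoc]
  have hw : ∀ w, w ᵥ* (M * R)ᵀ = 0 → w = 0 := by
    intro w hw
    rw [Matrix.vecMul_transpose, ← Matrix.mulVec_mulVec] at hw
    have h1 : R *ᵥ w = ∑ j, w j • c j := by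
      ext i
      simp [Matrix.mulVec, dotProduct, R, mul_comm]
    have h2 : ∑ j, w j • b j = 0 := by
      apply Subtype.ext
      rw [h1] at hw
      have h3 : M.mulVecLin (∑ j, w j • c j) = 0 := hw
      rw [map_sum] at h3
      simpa [← hc] using h3
    ext j
    exact Fintype.linearIndependent_iff.1 b.linearIndependent w h2 j
  simpa using det_mul_transpose_ne_zero hw

theorem le_rank_of_det_compression_ne_zero {ι κ : Type*} [Fintype ι] [Fintype κ] {r : ℕ}
    {L : Matrix (Fin r) ι ℝ} {M : Matrix ι κ ℝ} {R : Matrix κ (Fin r) ℝ}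
    (h : (L * M * R).det ≠ 0) : r ≤ M.rank := by
  have h1 : (L * M * R).rank = r := by
    rw [Matrix.rank_of_isUnit _ ((Matrix.isUnit_iff_isUnit_det _).2 h.isUnit)]
    simp
  calc r = (L * M * R).rank := h1.symm
    _ ≤ (L * M).rank := Matrix.rank_mul_le_left _ _
    _ ≤ M.rank := Matrix.rank_mul_le_right _ _

/-- A consequence of the expansion of the determinant of a product along the columns. -/
theorem exists_det_submatrix_ne_zero_of_det_mul_ne_zero {p : ℕ} {κ : Type*} [Fintype κ]
    {X : Matrix (Fin p) κ ℝ} {Y : Matrix κ (Fin p) ℝ} (h : (X * Y).det ≠ 0) :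
    ∃ f : Fin p → κ, (X.submatrix id f).det ≠ 0 ∧ ∀ j, Y (f j) j ≠ 0 := by
  classical
  have hrows : (X * Y)ᵀ = fun j => ∑ i, Y i j • Xᵀ i := by
    ext j a
    simp [Matrix.mul_apply, mul_comm]
  have hdet : (X * Y).det =
      -- Cauchy–Binet before grouping: one column of `X` is chosen for each column of the product,
      -- and one nonzero term suffices.
      ∑ f : Fin p → κ, (∏ j, Y (f j) j) * (X.submatrix id f).det := by
    rw [← Matrix.det_transpose, hrows]
    change Matrix.detRowAlternating.toMultilinearMap _ = _
    rw [MultilinearMap.map_sum]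
    refine Finset.sum_congr rfl fun f _ => ?_
    rw [MultilinearMap.map_smul_univ, ← Matrix.det_transpose (X.submatrix id f)]
    rfl
  rw [hdet] at h
  obtain ⟨f, -, hf⟩ := Finset.exists_ne_zero_of_sum_ne_zero h
  exact ⟨f, right_ne_zero_of_mul hf,
    fun j => Finset.prod_ne_zero_iff.1 (left_ne_zero_of_mul hf) j (Finset.mem_univ j)⟩

theorem injective_of_det_submatrix_ne_zero {p : ℕ} {κ : Type*}
    {X : Matrix (Fin p) κ ℝ} {f : Fin p → κ} (h : (X.submatrix id f).det ≠ 0) :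
    Function.Injective f := by
  intro i j hij
  by_contra hne
  exact h (Matrix.det_zero_of_column_eq hne fun k => by simp [hij])

end LinearAlgebra

/-! ### The controllability matrix -/

section Controllability

open Matrix

variable {n m : ℕ}

theorem vecMul_pow_mul_eq_zero {A : Matrix (Fin n) (Fin n) ℝ} {B : Matrix (Fin n) (Fin m) ℝ}
    {v : Fin n → ℝ} (h : v ᵥ* controllabilityMatrix A B = 0) (k : ℕ) : v ᵥ* (A ^ k * B) = 0 := by
  -- For `n = 0` the remainder below cannot have `natDegree < n`. Otherwise Cayley–Hamilton reduces
  -- every power of `A` to exponents below `n`.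
  rcases Nat.eq_zero_or_pos n with rfl | hn
  · ext j; simp [Matrix.vecMul, dotProduct]
  have hlt : ∀ i < n, v ᵥ* (A ^ i * B) = 0 := by
    intro i hi
    ext j
    exact congrFun h (⟨i, hi⟩, j)
  have hdeg : (Polynomial.X ^ k %ₘ A.charpoly).natDegree < n := by
    have hA : A.charpoly.natDegree = n := by simp
    have h1 := Polynomial.natDegree_modByMonic_lt (Polynomial.X ^ k) A.charpoly_monic (by
      intro h1
      rw [h1, Polynomial.natDegree_one] at hA
      omega)
    exact h1.trans_eq hA
  rw [Matrix.pow_eq_aeval_mod_charpoly, Polynomial.aeval_eq_sum_range' hdeg, Matrix.sum_mul,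
    Matrix.vecMul_sum]
  refine Finset.sum_eq_zero fun i hi => ?_
  rw [Matrix.smul_mul, Matrix.vecMul_smul, hlt i (Finset.mem_range.1 hi), smul_zero]

theorem exists_controllabilityMatrix_eq (A : Matrix (Fin n) (Fin n) ℝ)
    (B : Matrix (Fin n) (Fin m) ℝ) : ∃ N : Matrix (Fin n ⊕ Fin m) (Fin n × Fin m) ℝ,
      controllabilityMatrix A B = Matrix.fromCols A B * N := by
  -- A block `A ^ k * B` with `k > 0` is `A` times the preceding block; the block `k = 0` is `B`
  -- times the identity.
  refine ⟨Matrix.fromRows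
    (Matrix.of fun i kj => if (kj.1 : ℕ) = 0 then 0 else (A ^ ((kj.1 : ℕ) - 1) * B) i kj.2)
    (Matrix.of fun i kj => if (kj.1 : ℕ) = 0 ∧ i = kj.2 then 1 else 0), ?_⟩
  rw [Matrix.fromCols_mul_fromRows]
  ext i ⟨k, j⟩
  rcases k with ⟨_ | k, hk⟩
  · simp only [controllabilityMatrix, Matrix.of_apply, pow_zero, Matrix.one_mul]
    simp [Matrix.mul_apply]
  · simp [controllabilityMatrix, pow_succ', Matrix.mul_assoc, Matrix.mul_apply (M := A)]
    simp [Matrix.mul_apply (M := B)]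

/-- Full row rank carries over to the controllability matrix if it has the rank of `[A,B]`. -/
theorem vecMul_mul_controllabilityMatrix_eq_zero {p : ℕ} {A : Matrix (Fin n) (Fin n) ℝ}
    {B : Matrix (Fin n) (Fin m) ℝ} {C : Matrix (Fin p) (Fin n) ℝ}
    (hr : (Matrix.fromCols A B).rank ≤ (controllabilityMatrix A B).rank) {w : Fin p → ℝ}
    (hw : w ᵥ* (C * controllabilityMatrix A B) = 0) : w ᵥ* (C * Matrix.fromCols A B) = 0 := by
  obtain ⟨N, hN⟩ := exists_controllabilityMatrix_eq A B
  have hle : LinearMap.range (controllabilityMatrix A B).mulVecLin ≤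
      LinearMap.range (Matrix.fromCols A B).mulVecLin := by
    rw [hN, Matrix.mulVecLin_mul]
    exact LinearMap.range_comp_le_range _ _
  -- One column space contains the other and has no larger dimension, so they have the same left
  -- annihilator.
  have heq := Submodule.eq_of_le_of_finrank_le hle hr
  rw [← Matrix.vecMul_vecMul] at hw ⊢
  refine dotProduct_eq_zero _ fun z => ?_
  have hz : (Matrix.fromCols A B).mulVecLin z ∈
    LinearMap.range (controllabilityMatrix A B).mulVecLin := heq ▸ ⟨z, rfl⟩
  obtain ⟨z', hz'⟩ := hz
  simp only [Matrix.mulVecLin_apply] at hz'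
  rw [← Matrix.dotProduct_mulVec, ← hz', Matrix.dotProduct_mulVec, hw, zero_dotProduct]

/-- Output controllability is the full row rank of `C Q(A,B)`. -/
theorem outputControllable_iff {p : ℕ} (A : Matrix (Fin n) (Fin n) ℝ)
    (B : Matrix (Fin n) (Fin m) ℝ) (C : Matrix (Fin p) (Fin n) ℝ) :
    OutputControllable A B C ↔ ∀ w, w ᵥ* (C * controllabilityMatrix A B) = 0 → w = 0 := by
  have hcomp : ∀ (k : ℕ) (y : Fin m → ℝ),
      ((A.mulVecLin.toContinuousLinearMap) ^ k) (B.mulVecLin.toContinuousLinearMap y) =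
        (A ^ k * B) *ᵥ y := by
    intro k y
    induction k with
    | zero => simp
    | succ k ih =>
      rw [pow_succ', pow_succ', Matrix.mul_assoc, ← Matrix.mulVec_mulVec, ← ih]
      rfl
  constructor
  · intro h w hw
    refine dotProduct_eq_zero _ fun yf => ?_
    obtain ⟨T, u, x, hT, hx, rfl⟩ := h 0 yf
    let l : (Fin n → ℝ) →L[ℝ] ℝ := (dotProductBilin ℝ ℝ (w ᵥ* C)).toContinuousLinearMap
    have hl := functional_trajectory_eq_zero A.mulVecLin.toContinuousLinearMap
      B.mulVecLin.toContinuousLinearMap l (T := T) (u := u) (x := x) (fun k y => by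
        rw [hcomp]
        change (w ᵥ* C) ⬝ᵥ _ = 0
        rw [Matrix.dotProduct_mulVec, vecMul_pow_mul_eq_zero (by rwa [Matrix.vecMul_vecMul]),
          zero_dotProduct]) hx.integrable_input hx.continuousOn
      (fun t ht => by simpa using hx.eq_integral t ht) T ⟨hT.le, le_rfl⟩
    rw [Matrix.dotProduct_mulVec]
    exact hl
  · intro h x₀ yf
    obtain ⟨u, x, hu, hx0, hx1, hx⟩ := exists_control_of_forall_functional
      A.mulVecLin.toContinuousLinearMap B.mulVecLin.toContinuousLinearMap
      C.mulVecLin.toContinuousLinearMap (fun f hf => by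
        have hw : (fun i => f (Pi.single i 1)) = (0 : Fin p → ℝ) := by
          have hdot : ∀ z, (fun i => f (Pi.single i 1)) ⬝ᵥ z = f z := fun z => by
            rw [LinearMap.pi_apply_eq_sum_univ f z]
            simp [dotProduct, mul_comm, ← Pi.single_apply, ← Pi.single_comm]
          refine h _ ?_
          ext ⟨k, j⟩
          have h1 := hf k (Pi.single j 1)
          rw [hcomp, ← hdot] at h1
          rw [← Matrix.vecMul_vecMul]
          change _ ⬝ᵥ (C *ᵥ _) = 0 at h1
          rw [Matrix.dotProduct_mulVec, Matrix.mulVec_single_one] at h1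
          exact h1
        refine LinearMap.pi_ext' fun i => LinearMap.ext_ring ?_
        simpa using congrFun hw i) x₀ yf
    have hxc : Continuous x := continuous_iff_continuousAt.2 fun t => (hx t).continuousAt
    refine ⟨1, u, x, one_pos, ⟨hu.intervalIntegrable _ _, hxc.continuousOn, fun t _ => ?_⟩, hx1⟩
    have hint := intervalIntegral.integral_eq_sub_of_hasDerivAt (a := 0) (b := t)
      (fun s _ => hx s) (Continuous.intervalIntegrable (by fun_prop) _ _)
    rw [hx0] at hint
    change x t = x₀ + ∫ s in (0 : ℝ)..t, (A.mulVecLin.toContinuousLinearMap (x s) +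
      B.mulVecLin.toContinuousLinearMap (u s))
    rw [hint, add_sub_cancel]

end Controllability

/-! ### Polynomial paths of matrices -/

section PolynomialPath

open Matrix

/-- The entries of `M t` are polynomials in `t`. -/
def IsPolynomialPath {ι κ : Type*} (M : ℝ → Matrix ι κ ℝ) : Prop :=
  ∃ P : Matrix ι κ (Polynomial ℝ), ∀ t, M t = P.map (Polynomial.evalRingHom t)

namespace IsPolynomialPath

variable {ι κ ν : Type*}

theorem const (M : Matrix ι κ ℝ) : IsPolynomialPath fun _ => M :=
  ⟨M.map Polynomial.C, fun t => by ext; simp⟩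

theorem lineMap (M N : Matrix ι κ ℝ) : IsPolynomialPath fun t => M + t • (N - M) :=
  ⟨Matrix.of fun i j => Polynomial.C (M i j) + Polynomial.X * Polynomial.C (N i j - M i j),
    fun t => by ext; simp⟩

theorem mul [Fintype κ] {M : ℝ → Matrix ι κ ℝ} {N : ℝ → Matrix κ ν ℝ}
    (hM : IsPolynomialPath M) (hN : IsPolynomialPath N) : IsPolynomialPath fun t => M t * N t := by
  obtain ⟨P, hP⟩ := hM
  obtain ⟨R, hR⟩ := hN
  exact ⟨P * R, fun t => by simp only [Matrix.map_mul, hP, hR]⟩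

theorem pow [Fintype ι] [DecidableEq ι] {M : ℝ → Matrix ι ι ℝ} (hM : IsPolynomialPath M) (k : ℕ) :
    IsPolynomialPath fun t => M t ^ k := by
  induction k with
  | zero => simpa using const (1 : Matrix ι ι ℝ)
  | succ k ih => simpa only [pow_succ] using ih.mul hM

theorem fromCols {M : ℝ → Matrix ι κ ℝ} {N : ℝ → Matrix ι ν ℝ}
    (hM : IsPolynomialPath M) (hN : IsPolynomialPath N) :
    IsPolynomialPath fun t => Matrix.fromCols (M t) (N t) := by
  obtain ⟨P, hP⟩ := hM
  obtain ⟨R, hR⟩ := hN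
  refine ⟨Matrix.fromCols P R, fun t => ?_⟩
  ext i (j | j) <;> simp [hP, hR]

theorem controllabilityMatrix {n m : ℕ} {A : ℝ → Matrix (Fin n) (Fin n) ℝ}
    {B : ℝ → Matrix (Fin n) (Fin m) ℝ} (hA : IsPolynomialPath A) (hB : IsPolynomialPath B) :
    IsPolynomialPath fun t => StructuredSystem.controllabilityMatrix (A t) (B t) := by
  choose P hP using fun k => (hA.pow k).mul hB
  refine ⟨Matrix.of fun i kj => P kj.1 i kj.2, fun t => ?_⟩
  ext i ⟨k, j⟩
  simp [StructuredSystem.controllabilityMatrix, hP]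

theorem exists_det_eq_eval [Fintype ι] [DecidableEq ι] {M : ℝ → Matrix ι ι ℝ}
    (hM : IsPolynomialPath M) : ∃ q : Polynomial ℝ, ∀ t, (M t).det = q.eval t := by
  obtain ⟨P, hP⟩ := hM
  refine ⟨P.det, fun t => ?_⟩
  rw [hP, ← Polynomial.coe_evalRingHom, RingHom.map_det]
  rfl

/-- Two minors along polynomial paths that do not vanish identically have a common nonzero. -/
theorem exists_det_ne_zero_and_det_ne_zero [Fintype ι] [DecidableEq ι] [Fintype κ] [DecidableEq κ]
    {M : ℝ → Matrix ι ι ℝ} {N : ℝ → Matrix κ κ ℝ} (hM : IsPolynomialPath M)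
    (hN : IsPolynomialPath N) {a b : ℝ} (ha : (M a).det ≠ 0) (hb : (N b).det ≠ 0) :
    ∃ t, (M t).det ≠ 0 ∧ (N t).det ≠ 0 := by
  obtain ⟨q, hq⟩ := hM.exists_det_eq_eval
  obtain ⟨r, hr⟩ := hN.exists_det_eq_eval
  rw [hq] at ha
  rw [hr] at hb
  -- A nonzero real polynomial is nonzero at some real point.
  have hqr : q * r ≠ 0 := mul_ne_zero (by rintro rfl; simp at ha) (by rintro rfl; simp at hb)
  obtain ⟨t, ht⟩ : ∃ t, (q * r).eval t ≠ 0 := by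
    by_contra! h0
    exact hqr (Polynomial.funext fun t => by simpa using h0 t)
  rw [Polynomial.eval_mul] at ht
  exact ⟨t, by rw [hq]; exact left_ne_zero_of_mul ht, by rw [hr]; exact right_ne_zero_of_mul ht⟩

end IsPolynomialPath

end PolynomialPath

/-! ### Generic rank -/

section GenericRank

variable {Θ ι κ : Type*} [Fintype κ]

theorem bddAbove_range_rank (P : Θ → Matrix ι κ ℝ) : BddAbove (Set.range fun θ => (P θ).rank) :=
  ⟨Fintype.card κ, by rintro _ ⟨θ, rfl⟩; exact Matrix.rank_le_card_width _⟩

theorem rank_le_genericRank (P : Θ → Matrix ι κ ℝ) (θ : Θ) : (P θ).rank ≤ genericRank P :=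
  le_ciSup (bddAbove_range_rank P) θ

theorem exists_rank_eq_genericRank [Nonempty Θ] (P : Θ → Matrix ι κ ℝ) :
    ∃ θ, (P θ).rank = genericRank P :=
  Nat.sSup_mem (Set.range_nonempty _) (bddAbove_range_rank P)

theorem rank_fromCols_le_grank {n m : ℕ} {A : StructuredMatrix (Fin n) (Fin n)}
    {B : StructuredMatrix (Fin n) (Fin m)} (A' : Realization A) (B' : Realization B) :
    (Matrix.fromCols A'.1 B'.1).rank ≤ grank (Matrix.fromCols A B) :=
  rank_le_genericRank (fun M : Realization (Matrix.fromCols A B) => M.1)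
    ⟨Matrix.fromCols A'.1 B'.1, by rintro i (j | j) h; exacts [A'.2 i j h, B'.2 i j h]⟩

instance {ι κ : Type*} (S : StructuredMatrix ι κ) : Nonempty (Realization S) :=
  ⟨⟨0, fun _ _ _ => rfl⟩⟩

/-- The point of the line through two realizations. -/
def lineMapRealization {ι κ : Type*} {S : StructuredMatrix ι κ} (M N : Realization S) (t : ℝ) :
    Realization S :=
  ⟨M.1 + t • (N.1 - M.1), fun i j h => by simp [M.2 i j h, N.2 i j h]⟩

end GenericRank

/-! ### Restriction to the input-reachable states -/

section Reachable

variable {n m : ℕ} {A : StructuredMatrix (Fin n) (Fin n)} {B : StructuredMatrix (Fin n) (Fin m)}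

theorem inputReachable_of_input {i : Fin n} {j : Fin m} (h : B i j) : InputReachable A B i :=
  ⟨j, Relation.ReflTransGen.single h⟩

theorem inputReachable_of_state {i j : Fin n} (hj : InputReachable A B j) (h : A i j) :
    InputReachable A B i := by
  obtain ⟨k, hk⟩ := hj
  exact ⟨k, hk.tail h⟩

open Classical in
/-- The realization of `Ā_r` obtained from a realization of `Ā`. -/
noncomputable def restrictRealization (A' : Realization A) (B : StructuredMatrix (Fin n) (Fin m)) :
    Realization (reachablePart A B) :=
  ⟨Matrix.of fun i j => if InputReachable A B i ∧ InputReachable A B j then A'.1 i j else 0, by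
    intro i j h
    simp only [Matrix.of_apply, ite_eq_right_iff]
    exact fun hij => A'.2 i j fun hA => h ⟨hA, hij⟩⟩

/-- A realization of `Ā_r` as one of `Ā`. -/
def ofReachablePart (A' : Realization (reachablePart A B)) : Realization A :=
  ⟨A'.1, fun i j h => A'.2 i j fun h' => h h'.1⟩

/-- Reachability propagates along edges, so the deleted entries of `A` only ever meet zero entries
of `A ^ k * B`. The support statement is what carries the induction. -/
theorem restrict_pow_mul (A' : Realization A) (B' : Realization B) (k : ℕ) :
    A'.1 ^ k * B'.1 = (restrictRealization A' B).1 ^ k * B'.1 ∧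
      ∀ i j, ¬ InputReachable A B i → (A'.1 ^ k * B'.1) i j = 0 := by
  induction k with
  | zero =>
    refine ⟨by simp, fun i j h => ?_⟩
    rw [pow_zero, Matrix.one_mul]
    exact B'.2 i j fun h' => h (inputReachable_of_input h')
  | succ k ih =>
    have h1 : ∀ i j, ¬ InputReachable A B i → (A'.1 ^ (k + 1) * B'.1) i j = 0 := by
      intro i j hi
      rw [pow_succ', Matrix.mul_assoc, Matrix.mul_apply]
      refine Finset.sum_eq_zero fun l _ => ?_
      by_cases hl : InputReachable A B l
      · rw [A'.2 i l fun h => hi (inputReachable_of_state hl h), zero_mul]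
      · rw [ih.2 l j hl, mul_zero]
    refine ⟨?_, h1⟩
    ext i j
    by_cases hi : InputReachable A B i
    · rw [pow_succ', pow_succ', Matrix.mul_assoc, Matrix.mul_assoc, ← ih.1, Matrix.mul_apply,
        Matrix.mul_apply]
      refine Finset.sum_congr rfl fun l _ => ?_
      by_cases hl : InputReachable A B l
      · simp [restrictRealization, hi, hl]
      · rw [ih.2 l j hl, mul_zero, mul_zero]
    · rw [h1 i j hi, pow_succ', Matrix.mul_assoc, Matrix.mul_apply]
      exact (Finset.sum_eq_zero fun l _ => by simp [restrictRealization, hi]).symm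

theorem controllabilityMatrix_restrict (A' : Realization A) (B' : Realization B) :
    controllabilityMatrix (restrictRealization A' B).1 B'.1 = controllabilityMatrix A'.1 B'.1 := by
  ext i ⟨k, j⟩
  simp only [controllabilityMatrix, Matrix.of_apply, (restrict_pow_mul A' B' k).1]

end Reachable

/-! ### Linkings -/

section Linking

variable {n m p : ℕ} {A : StructuredMatrix (Fin n) (Fin n)} {B : StructuredMatrix (Fin n) (Fin m)}
  {C : StructuredMatrix (Fin p) (Fin n)}

/-- The source vertex of a column of `[Ā,B̄]`. -/
def sourceVertex (n m p : ℕ) : Fin n ⊕ Fin m → AuxVertex n m p :=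
  Sum.elim AuxVertex.x2 AuxVertex.u2

theorem auxDigraph_adj_source {s : Fin n ⊕ Fin m} {v : AuxVertex n m p} :
    (auxDigraph A B C).Adj (sourceVertex n m p s) v ↔
      ∃ i, v = AuxVertex.x1 i ∧ Matrix.fromCols A B i s := by
  rcases s with s | s <;> rcases v with v | v | v | v <;> simp [auxDigraph, sourceVertex]

theorem auxDigraph_adj_x1 {i : Fin n} {v : AuxVertex n m p} :
    (auxDigraph A B C).Adj (AuxVertex.x1 i) v ↔ ∃ k, v = AuxVertex.y0 k ∧ C k i := by
  rcases v with v | v | v | v <;> simp [auxDigraph]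

theorem not_auxDigraph_adj_y0 {k : Fin p} {v : AuxVertex n m p} :
    ¬ (auxDigraph A B C).Adj (AuxVertex.y0 k) v := by
  rcases v with v | v | v | v <;> simp [auxDigraph]

/-- The digraph has three layers and every edge goes to the next one, so a path from the first to
the last has exactly two edges. -/
theorem exists_eq_of_isChain {l : List (AuxVertex n m p)} (hl : l ≠ [])
    (hc : l.IsChain (auxDigraph A B C).Adj) (hs : l.head hl ∈ auxSources n m p)
    (ht : l.getLast hl ∈ auxSinks n m p) :
    ∃ s i k, l = [sourceVertex n m p s, AuxVertex.x1 i, AuxVertex.y0 k] ∧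
      Matrix.fromCols A B i s ∧ C k i := by
  obtain ⟨s, hs⟩ : ∃ s, l.head hl = sourceVertex n m p s := by
    rcases hs with ⟨i, hi⟩ | ⟨j, hj⟩
    exacts [⟨.inl i, hi.symm⟩, ⟨.inr j, hj.symm⟩]
  obtain ⟨k, hk⟩ := ht
  rcases l with _ | ⟨a, _ | ⟨b, _ | ⟨c, _ | ⟨d, l⟩⟩⟩⟩
  · exact absurd rfl hl
  · simp only [List.head_cons, List.getLast_singleton] at hs hk
    rw [hs] at hk
    rcases s with s | s <;> simp [sourceVertex] at hk
  all_goals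
    simp only [List.head_cons] at hs
    subst hs
    simp only [List.isChain_cons_cons] at hc
    obtain ⟨i, rfl, hi⟩ := auxDigraph_adj_source.1 hc.1
  · simp at hk
  all_goals obtain ⟨k', rfl, hk'⟩ := auxDigraph_adj_x1.1 hc.2.1
  · exact ⟨s, i, k', rfl, hi, hk'⟩
  · exact absurd hc.2.2.1 not_auxDigraph_adj_y0

/-- Since the layers are disjoint, simplicity is automatic and disjointness of the paths is
injectivity in each layer. -/
theorem hasLinking_iff {l : ℕ} :
    HasLinking (auxDigraph A B C) (auxSources n m p) (auxSinks n m p) l ↔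
      ∃ (s : Fin l → Fin n ⊕ Fin m) (f : Fin l → Fin n) (y : Fin l → Fin p),
        s.Injective ∧ f.Injective ∧ y.Injective ∧
          ∀ k, Matrix.fromCols A B (f k) (s k) ∧ C (y k) (f k) := by
  constructor
  · rintro ⟨P, hP, hd⟩
    choose s f y hsupp hadj using fun k => exists_eq_of_isChain (P k).ne_nil (P k).isChain (hP k).1 (hP k).2
    have hne : ∀ k k', k ≠ k' → ∀ v ∈ (P k).support, v ∉ (P k').support :=
      fun k k' h v hv hv' => hd h hv hv'
    refine ⟨s, f, y, ?_, ?_, ?_, hadj⟩ <;> intro k k' h <;> by_contra hkk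
    · exact hne k k' hkk (sourceVertex n m p (s k)) (by simp [hsupp]) (by simp [hsupp, h])
    · exact hne k k' hkk (AuxVertex.x1 (f k)) (by simp [hsupp]) (by simp [hsupp, h])
    · exact hne k k' hkk (AuxVertex.y0 (y k)) (by simp [hsupp]) (by simp [hsupp, h])
  · rintro ⟨s, f, y, hs, hf, hy, h⟩
    have hx1 : ∀ s i, sourceVertex n m p s ≠ AuxVertex.x1 i := by
      rintro (s | s) i <;> simp [sourceVertex]
    have hy0 : ∀ s k, sourceVertex n m p s ≠ AuxVertex.y0 k := by
      rintro (s | s) i <;> simp [sourceVertex]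
    have hinj : Function.Injective (sourceVertex n m p) := by
      rintro (s | s) (t | t) h <;> simp_all [sourceVertex]
    refine ⟨fun k => ⟨[sourceVertex n m p (s k), AuxVertex.x1 (f k), AuxVertex.y0 (y k)], by simp,
      ?_, ?_⟩, fun k => ⟨?_, ?_⟩, fun k k' hkk => ?_⟩
    · simp only [List.isChain_cons_cons, List.isChain_singleton, and_true]
      exact ⟨auxDigraph_adj_source.2 ⟨_, rfl, (h k).1⟩, auxDigraph_adj_x1.2 ⟨_, rfl, (h k).2⟩⟩
    · simp [hx1, hy0]
    · change sourceVertex n m p (s k) ∈ _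
      rcases s k with i | j
      exacts [.inl ⟨i, rfl⟩, .inr ⟨j, rfl⟩]
    · exact ⟨y k, rfl⟩
    · simp [List.disjoint_left, hx1, hy0, fun a b => (hx1 a b).symm, fun a b => (hy0 a b).symm,
        hinj.eq_iff, hs.eq_iff, hf.eq_iff, hy.eq_iff, hkk]

end Linking

/-! ### Linkings and nonzero minors; proof of the theorem -/

section Main

open Matrix

variable {n m p : ℕ} {A : StructuredMatrix (Fin n) (Fin n)} {B : StructuredMatrix (Fin n) (Fin m)}
  {C : StructuredMatrix (Fin p) (Fin n)}

/-- Full row rank of a realization of `C̄ [Ā,B̄]` gives a linking that covers the outputs. -/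
theorem hasLinking_of_vecMul_injective (A' : Realization A) (B' : Realization B)
    (C' : Realization C) (h : ∀ w, w ᵥ* (C'.1 * Matrix.fromCols A'.1 B'.1) = 0 → w = 0) :
    HasLinking (auxDigraph A B C) (auxSources n m p) (auxSinks n m p) p := by
  obtain ⟨s, hs, -⟩ := exists_det_submatrix_ne_zero_of_det_mul_ne_zero (det_mul_transpose_ne_zero h)
  have hsinj := injective_of_det_submatrix_ne_zero hs
  have hmul : (C'.1 * Matrix.fromCols A'.1 B'.1).submatrix id s =
      C'.1 * (Matrix.fromCols A'.1 B'.1).submatrix id s := rfl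
  rw [hmul] at hs
  obtain ⟨f, hf, hfs⟩ := exists_det_submatrix_ne_zero_of_det_mul_ne_zero hs
  have hfinj := injective_of_det_submatrix_ne_zero hf
  rw [Matrix.det_apply] at hf
  -- A nonzero Leibniz term assigns to the states `f k` distinct outputs `σ k`, which end the paths.
  obtain ⟨σ, -, hσ⟩ := Finset.exists_ne_zero_of_sum_ne_zero hf
  have hσ' : ∀ k, C'.1 (σ k) (f k) ≠ 0 := fun k =>
    Finset.prod_ne_zero_iff.1 (right_ne_zero_of_smul hσ) k (Finset.mem_univ k)
  refine hasLinking_iff.2 ⟨s, f, σ, hsinj, hfinj, σ.injective, fun k => ⟨?_, ?_⟩⟩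
  · by_contra hk
    refine hfs k ?_
    rw [Matrix.submatrix_apply, id]
    rcases hsk : s k with j | j <;> rw [hsk] at hk
    exacts [A'.2 _ _ hk, B'.2 _ _ hk]
  · by_contra hk
    exact hσ' k (C'.2 _ _ hk)

/-- A linking that covers the outputs gives a realization of `C̄ [Ā,B̄]` with a nonzero minor. -/
theorem exists_realization_of_hasLinking
    (h : HasLinking (auxDigraph A B C) (auxSources n m p) (auxSinks n m p) p) :
    ∃ (A' : Realization A) (B' : Realization B) (C' : Realization C)
      (R : Matrix (Fin n ⊕ Fin m) (Fin p) ℝ),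
      (C'.1 * Matrix.fromCols A'.1 B'.1 * R).det ≠ 0 := by
  classical
  obtain ⟨s, f, y, hs, hf, hy, hadj⟩ := hasLinking_iff.1 h
  -- `M` and `C'` are the indicators of the edges used by the linking. On its sources their product
  -- is the permutation matrix of `y`.
  let M : Matrix (Fin n) (Fin n ⊕ Fin m) ℝ :=
    Matrix.of fun i c => if ∃ k, i = f k ∧ c = s k then 1 else 0
  let C' : Matrix (Fin p) (Fin n) ℝ := Matrix.of fun a i => if ∃ k, a = y k ∧ i = f k then 1 else 0
  have hM : Matrix.fromCols M.toCols₁ M.toCols₂ = M := Matrix.fromCols_toCols M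
  refine ⟨⟨M.toCols₁, fun i j hij => ?_⟩, ⟨M.toCols₂, fun i j hij => ?_⟩, ⟨C', fun a i hai => ?_⟩,
    (1 : Matrix (Fin n ⊕ Fin m) (Fin n ⊕ Fin m) ℝ).submatrix id s, ?_⟩
  · refine if_neg ?_
    rintro ⟨k, rfl, hk⟩
    exact hij (by simpa [← hk] using (hadj k).1)
  · refine if_neg ?_
    rintro ⟨k, rfl, hk⟩
    exact hij (by simpa [← hk] using (hadj k).1)
  · refine if_neg ?_
    rintro ⟨k, rfl, rfl⟩
    exact hai (hadj k).2
  · dsimp only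
    rw [hM]
    have hR : C' * M * (1 : Matrix (Fin n ⊕ Fin m) (Fin n ⊕ Fin m) ℝ).submatrix id s =
        (C' * M).submatrix id s := by
      ext i j
      simp [Matrix.mul_apply (M := C' * M), Matrix.one_apply]
    have hperm : ((C' * M).submatrix id s).submatrix (Equiv.ofBijective y hy.bijective_of_finite) id
        = 1 := by
      ext k l
      simp only [Matrix.submatrix_apply, Matrix.mul_apply, Equiv.ofBijective_apply, id, C', M,
        Matrix.of_apply, hy.eq_iff, hs.eq_iff]
      rw [Finset.sum_eq_single (f k)]
      · simp [hf.eq_iff, Matrix.one_apply]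
      · intro i _ hi
        rw [if_neg, zero_mul]
        rintro ⟨k', rfl, rfl⟩
        exact hi rfl
      · simp
    rw [hR]
    intro h0
    have := congrArg Matrix.det hperm
    rw [Matrix.det_permute] at this
    simp [h0] at this

end Main

theorem mainTheorem3 {n m p : ℕ} (A : StructuredMatrix (Fin n) (Fin n))
    (B : StructuredMatrix (Fin n) (Fin m)) (C : StructuredMatrix (Fin p) (Fin n))
    (h : grank (Matrix.fromCols (reachablePart A B) B) = grankQ A B) :
    StructurallyOutputControllable A B C ↔
      HasLinking (auxDigraph (reachablePart A B) B C) (auxSources n m p) (auxSinks n m p) p := by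
  constructor
  · rintro ⟨A', B', C', hc⟩
    rw [outputControllable_iff] at hc
    refine hasLinking_of_vecMul_injective (restrictRealization A' B) B' C' fun w hw => hc w ?_
    obtain ⟨N, hN⟩ := exists_controllabilityMatrix_eq (restrictRealization A' B).1 B'.1
    rw [← controllabilityMatrix_restrict, hN, ← Matrix.mul_assoc, ← Matrix.vecMul_vecMul, hw,
      Matrix.zero_vecMul]
  · intro hl
    obtain ⟨A₂, B₂, C', R₂, h₂⟩ := exists_realization_of_hasLinking hl
    obtain ⟨⟨A₁, B₁⟩, h₁⟩ := exists_rank_eq_genericRank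
      fun θ : Realization A × Realization B => controllabilityMatrix θ.1.1 θ.2.1
    dsimp only at h₁
    rw [← controllabilityMatrix_restrict] at h₁
    obtain ⟨L₁, R₁, hdet₁⟩ := exists_det_compression_ne_zero
      (controllabilityMatrix (restrictRealization A₁ B).1 B₁.1)
    have hA := IsPolynomialPath.lineMap (restrictRealization A₁ B).1 A₂.1
    have hB := IsPolynomialPath.lineMap B₁.1 B₂.1
    -- The minor of `Q` is nonzero at `t = 0`, that of `C * [A_r, B]` at `t = 1`; `C'` stays fixed.
    obtain ⟨t, ht₁, ht₂⟩ := IsPolynomialPath.exists_det_ne_zero_and_det_ne_zero (a := 0) (b := 1)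
      (((IsPolynomialPath.const L₁).mul (hA.controllabilityMatrix hB)).mul (.const R₁))
      (((IsPolynomialPath.const C'.1).mul (hA.fromCols hB)).mul (.const R₂))
      (by simpa using hdet₁) (by simpa using h₂)
    let A₃ := lineMapRealization (restrictRealization A₁ B) A₂ t
    let B₃ := lineMapRealization B₁ B₂ t
    -- At this `t` the matrix `Q` still has its generic rank, which by `h` bounds the rank of every
    -- realization of `[A_r, B]`.
    have hrank : (Matrix.fromCols A₃.1 B₃.1).rank ≤ (controllabilityMatrix A₃.1 B₃.1).rank :=
      calc _ ≤ grank (Matrix.fromCols (reachablePart A B) B) := rank_fromCols_le_grank A₃ B₃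
        _ = _ := h.trans h₁.symm
        _ ≤ _ := le_rank_of_det_compression_ne_zero ht₁
    refine ⟨ofReachablePart A₃, B₃, C', (outputControllable_iff _ _ _).2 fun w hw => ?_⟩
    have hw' := vecMul_mul_controllabilityMatrix_eq_zero hrank hw
    refine Matrix.eq_zero_of_vecMul_eq_zero ht₂ ?_
    change Matrix.vecMul w (C'.1 * Matrix.fromCols A₃.1 B₃.1 * R₂) = 0
    rw [← Matrix.vecMul_vecMul, hw', Matrix.zero_vecMul]
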